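/- Let $\Delta$ be the open unit disc, $\mathrm{Aut}(\Delta)$ its group of biholomorphic self-maps, and let $X=\Delta/G$ be a compact hyperbolic Riemann surface, i.e. $G\le \mathrm{Aut}(\Delta)$ is a subgroup acting freely and properly discontinuously on $\Delta$ with compact quotient. Let $\widehat G=\varprojlim G/N$ ($N$ ranging over the finite-index normal subgroups of $G$) be the profinite completion, and let $H_\infty(X)=\Delta\times_G\widehat G$ be the quotient of $\Delta\times\widehat G$ by the action $g\cdot(z,a)=(gz,ga)$, with projection $(z,a)\mapsto[z,a]$. The base leaf is $\{[z,1]: z\in\Delta\}$. A map $f:H_\infty(X)\to H_\infty(X)$ is holomorphic if it is continuous and holomorphic along the leaves: for every $z_0\in\Delta$ and $a\in\widehat G$ there are $b\in\widehat G$ and a map $\psi:\Delta\to\Delta$, holomorphic near $z_0$, with $f([z,a])=[\psi(z),b]$ for all $z$ near $z_0$. Let $$\mathrm{ComAut}(X)=\{\gamma\in\mathrm{Aut}(\Delta)\;:\;\gamma G\gamma^{-1}\text{ and }G\text{ are commensurable}\},$$ where two subgroups are commensurable if their intersection has finite index in both. Proposition 4.12. There is a unique homomorphism $\rho$ from $\mathrm{ComAut}(X)$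 to the group of self-homeomorphisms of $H_\infty(X)$ such that $\rho(\gamma)([z,1])=[\gamma z,1]$ for all $\gamma\in\mathrm{ComAut}(X)$ and $z\in\Delta$. It is injective, and its image is exactly the set of all holomorphic self-homeomorphisms $\Phi$ of $H_\infty(X)$ that map the base leaf onto itself. In this sense the full group of holomorphic self-homeomorphisms of $H_\infty(X)$ that preserve the base leaf coincides with $\mathrm{ComAut}(X)$. -/

import Mathlib

open scoped Topology
open Complex.UnitDisc

/-- `f : 𝔻 → 𝔻` is holomorphic at (that is, in a neighbourhood of) the point `z₀` of the open unit
disc: near `z₀` it is the restriction of a function which is complex analytic at `z₀`. -/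
def DiscHolomorphicAt (f : 𝔻 → 𝔻) (z₀ : 𝔻) : Prop :=
  ∃ F : ℂ → ℂ, AnalyticAt ℂ F (z₀ : ℂ) ∧ ∀ᶠ z : 𝔻 in 𝓝 z₀, (f z : ℂ) = F (z : ℂ)

theorem discHolomorphicAt_id (z₀ : 𝔻) : DiscHolomorphicAt (fun z => z) z₀ :=
  ⟨fun z => z, analyticAt_id, Filter.Eventually.of_forall fun _ => rfl⟩

theorem DiscHolomorphicAt.comp {f g : 𝔻 → 𝔻} {z₀ : 𝔻} (hg : DiscHolomorphicAt g (f z₀))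
    (hf : DiscHolomorphicAt f z₀) (hfc : ContinuousAt f z₀) :
    DiscHolomorphicAt (fun z => g (f z)) z₀ := by
  obtain ⟨F, hF, hfF⟩ := hf
  obtain ⟨K, hK, hgK⟩ := hg
  refine ⟨fun z => K (F z), ?_, ?_⟩
  · have h0 : F (z₀ : ℂ) = (f z₀ : ℂ) := hfF.self_of_nhds.symm
    exact AnalyticAt.fun_comp (by rw [h0]; exact hK) hF
  · filter_upwards [hfF, hfc.eventually hgK] with z h1 h2
    rw [h2, h1]

/-- `Aut(Δ)`: the group (under composition) of biholomorphic self-maps of the open unit disc. -/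
noncomputable def DiscAut : Subgroup (𝔻 ≃ₜ 𝔻) where
  carrier := {f | (∀ z, DiscHolomorphicAt f z) ∧ ∀ z, DiscHolomorphicAt f.symm z}
  one_mem' := ⟨discHolomorphicAt_id, discHolomorphicAt_id⟩
  mul_mem' := fun {f g} hf hg =>
    ⟨fun z => (hf.1 (g z)).comp (hg.1 z) g.continuous.continuousAt,
      fun z => (hg.2 (f.symm z)).comp (hf.2 z) f.symm.continuous.continuousAt⟩
  inv_mem' := fun {_} hf => ⟨hf.2, hf.1⟩

/-- The tautological action of `Aut(Δ)` on `Δ`; subgroups of `Aut(Δ)` act by restriction. -/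
noncomputable instance : MulAction DiscAut 𝔻 where
  smul g z := (g : 𝔻 ≃ₜ 𝔻) z
  one_smul _ := rfl
  mul_smul _ _ _ := rfl

/-- `G ≤ Aut(Δ)` acts freely and properly discontinuously on `Δ` with compact quotient `X = Δ/G`.
Equivalently, `G` is a torsion-free cocompact Fuchsian group, that is, the group of deck
transformations of the holomorphic universal covering `Δ → X` of a compact hyperbolic Riemann
surface. -/
structure UniformizesCompactSurface (G : Subgroup DiscAut) : Prop where
  free : ∀ (g : G) (z : 𝔻), g • z = z → g = 1
  properlyDiscontinuous : ProperlyDiscontinuousSMul G 𝔻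
  compact_quotient : CompactSpace (Quotient (MulAction.orbitRel G 𝔻))

/-- `ComAut(Δ/G)`: the group of all `γ ∈ Aut(Δ)` such that `γ G γ⁻¹` and `G` are commensurable,
i.e. their intersection has finite index in both. -/
noncomputable abbrev ComAut (G : Subgroup DiscAut) : Subgroup DiscAut :=
  Subgroup.Commensurable.commensurator G

/-- The profinite completion `Ĝ`: the projective limit of the groups `G ⧸ N`, with `N` running
through the normal subgroups of finite index of `G`. -/
abbrev ProfiniteHat (G : Type) [Group G] : Type :=
  ProfiniteGrp.ProfiniteCompletion.completion (GrpCat.of G)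

/-- The natural homomorphism `G → Ĝ`. -/
def toProfiniteHat (G : Type) [Group G] : G →* ProfiniteHat G :=
  (ProfiniteGrp.ProfiniteCompletion.eta (GrpCat.of G)).hom

/-- The action of `G` on `Ĝ` by left translations. Together with the action on `Δ` it gives, for
`G ≤ Aut(Δ)`, the diagonal action `g • (z, a) = (g • z, g • a)` on `Δ × Ĝ`. -/
instance (G : Type) [Group G] : MulAction G (ProfiniteHat G) where
  smul g a := toProfiniteHat G g * a
  one_smul a := by
    change toProfiniteHat G 1 * a = a
    rw [map_one, one_mul]
  mul_smul g h a := by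
    change toProfiniteHat G (g * h) * a = toProfiniteHat G g * (toProfiniteHat G h * a)
    rw [map_mul, mul_assoc]

/-- The solenoid `H_∞(Δ/G) = Δ ×_G Ĝ`: the quotient of `Δ × Ĝ` by the diagonal action of `G`. -/
def Solenoid (G : Subgroup DiscAut) : Type :=
  Quotient (MulAction.orbitRel G (𝔻 × ProfiniteHat G))

/-- The quotient topology. -/
noncomputable instance (G : Subgroup DiscAut) : TopologicalSpace (Solenoid G) :=
  inferInstanceAs (TopologicalSpace (Quotient (MulAction.orbitRel G (𝔻 × ProfiniteHat G))))

/-- The projection `P_G : Δ × Ĝ → Δ ×_G Ĝ`. The leaves are the images of the slices `Δ × {a}`. -/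
noncomputable def Solenoid.proj (G : Subgroup DiscAut) (z : 𝔻) (a : ProfiniteHat G) : Solenoid G :=
  Quotient.mk (MulAction.orbitRel G (𝔻 × ProfiniteHat G)) (z, a)

/-- The base leaf: the image of the slice `Δ × {1}`. -/
def Solenoid.baseLeaf (G : Subgroup DiscAut) : Set (Solenoid G) :=
  Set.range fun z : 𝔻 => Solenoid.proj G z 1

/-- Holomorphic maps `f` of the solenoid to itself. The complex structure of `Δ ×_G Ĝ` is descended
from the one of `Δ × Ĝ`: each parametrized leaf `z ↦ P_G (z, a)` is holomorphic, with local
coordinate `z`. So `f` is holomorphic when it is continuous and, in these leaf coordinates, it is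
holomorphic in the leaf direction near every point. -/
def Solenoid.IsHolomorphic {G : Subgroup DiscAut} (f : Solenoid G → Solenoid G) : Prop :=
  Continuous f ∧ ∀ (z₀ : 𝔻) (a : ProfiniteHat G),
    ∃ (ψ : 𝔻 → 𝔻) (b : ProfiniteHat G), DiscHolomorphicAt ψ z₀ ∧
      ∀ᶠ z : 𝔻 in 𝓝 z₀, f (Solenoid.proj G z a) = Solenoid.proj G (ψ z) b

/-! The base leaf is dense in the solenoid, which is Hausdorff, so a continuous map is determined by
its restriction to that leaf. This gives uniqueness of `ρ`, its multiplicativity, and inverses.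
Moreover `G` is residually finite, being a finitely generated group of Möbius transformations, so `z
↦ [z,1]` is injective: the base leaf is a faithful copy of the disc, and `ρ` is injective.

Extending `γ` (`exists_isHolomorphic_extension`): put `H = G ∩ γ⁻¹Gγ`, of finite index in `G`. Then
`Ĥ` embeds in `Ĝ` as an open subgroup, so the solenoid is also a quotient of `Δ × Ĥ`. Conjugation by
`γ` extends to `k : Ĥ → Ĝ`, and `(z,a) ↦ [γz, k a]` descends.

Conversely, a holomorphic homeomorphism preserving the base leaf restricts to a holomorphic
bijection of the disc, hence to some `γ ∈ Aut(Δ)`. That `γ` commensurates `G` is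
`finiteIndex_conjMem_of_continuous`. By compactness, for `n` in a finite-index subgroup, `[γn⁻¹z,1]`
is close to `[γz,1]` uniformly in `z`. So for each `z` some `h ∈ G` brings `γn⁻¹z` hyperbolically
close to `γz`. A positive injectivity radius makes `h` locally constant, hence constant. Then
`hγn⁻¹γ⁻¹` has small displacement everywhere, which forces it to be the identity, so `γnγ⁻¹ = h ∈
G`. -/

/-! ### Holomorphic self-maps of the disc -/

/-- The extension by zero of a self-map of the unit disc to the complex plane. -/
noncomputable def discExtend (f : 𝔻 → 𝔻) (w : ℂ) : ℂ :=
  open Classical in if h : ‖w‖ < 1 then (f (mk w h) : ℂ) else 0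

theorem discExtend_coe (f : 𝔻 → 𝔻) (z : 𝔻) : discExtend f z = f z := by
  simp [discExtend, z.norm_lt_one]

theorem norm_discExtend_lt_one (f : 𝔻 → 𝔻) (w : ℂ) : ‖discExtend f w‖ < 1 := by
  unfold discExtend
  split_ifs
  · exact norm_lt_one _
  · simp

theorem isOpenEmbedding_unitDisc_coe : Topology.IsOpenEmbedding ((↑) : 𝔻 → ℂ) :=
  Metric.isOpen_ball.isOpenEmbedding_subtypeVal

instance : LocallyCompactSpace 𝔻 := isOpenEmbedding_unitDisc_coe.locallyCompactSpace

instance : T2Space 𝔻 := isEmbedding_coe.t2Space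

instance : ConnectedSpace 𝔻 :=
  Subtype.connectedSpace ((convex_ball (0 : ℂ) 1).isConnected ⟨0, by simp⟩)

theorem DiscHolomorphicAt.continuousAt {f : 𝔻 → 𝔻} {z : 𝔻} (hf : DiscHolomorphicAt f z) :
    ContinuousAt f z := by
  obtain ⟨F, hF, h⟩ := hf
  rw [isEmbedding_coe.continuousAt_iff]
  refine (ContinuousAt.comp (f := ((↑) : 𝔻 → ℂ)) hF.continuousAt
    continuous_coe.continuousAt).congr ?_
  filter_upwards [h] with w hw using hw.symm

theorem DiscHolomorphicAt.congr {f g : 𝔻 → 𝔻} {z : 𝔻} (hf : DiscHolomorphicAt f z)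
    (h : f =ᶠ[𝓝 z] g) : DiscHolomorphicAt g z := by
  obtain ⟨F, hF, hfF⟩ := hf
  refine ⟨F, hF, ?_⟩
  filter_upwards [hfF, h] with w h1 h2
  rw [← h2, h1]

theorem discHolomorphicAt_iff {f : 𝔻 → 𝔻} {z : 𝔻} :
    DiscHolomorphicAt f z ↔ AnalyticAt ℂ (discExtend f) z := by
  constructor
  · rintro ⟨F, hF, h⟩
    refine hF.congr ?_
    rw [← isOpenEmbedding_unitDisc_coe.map_nhds_eq, Filter.EventuallyEq, Filter.eventually_map]
    filter_upwards [h] with w hw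
    rw [discExtend_coe, hw]
  · intro h
    exact ⟨_, h, Filter.Eventually.of_forall fun w => (discExtend_coe f w).symm⟩

theorem analyticOnNhd_discExtend {f : 𝔻 → 𝔻} (hf : ∀ z, DiscHolomorphicAt f z) :
    AnalyticOnNhd ℂ (discExtend f) (Metric.ball 0 1) := by
  intro w hw
  have hw' : ‖w‖ < 1 := by simpa using hw
  exact discHolomorphicAt_iff.1 (hf (mk w hw'))

theorem DiscAut.discHolomorphicAt (T : DiscAut) (z : 𝔻) : DiscHolomorphicAt (T • ·) z :=
  T.2.1 z

theorem DiscAut.continuous_smul (T : DiscAut) : Continuous fun z : 𝔻 => T • z :=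
  (T : 𝔻 ≃ₜ 𝔻).continuous

theorem DiscAut.ext_smul {S T : DiscAut} (h : ∀ z : 𝔻, S • z = T • z) : S = T :=
  Subtype.ext (Homeomorph.ext h)

instance : ContinuousConstSMul DiscAut 𝔻 := ⟨DiscAut.continuous_smul⟩

/-- A bijective holomorphic self-map of the disc is an automorphism. -/
theorem exists_discAut_of_bijective {f : 𝔻 → 𝔻} (hf : Function.Bijective f)
    (hol : ∀ z, DiscHolomorphicAt f z) : ∃ T : DiscAut, ∀ z : 𝔻, T • z = f z := by
  -- Open mapping theorem; the constant alternative is excluded by injectivity at `0` and `1/2`.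
  have hopen : IsOpenMap f := by
    rcases (analyticOnNhd_discExtend hol).is_constant_or_isOpen
      (convex_ball 0 1).isPreconnected with ⟨w, hw⟩ | h
    · exfalso
      have key : ∀ z : 𝔻, (f z : ℂ) = w := fun z => by
        rw [← discExtend_coe]; exact hw z (by simpa using z.norm_lt_one)
      have h2 : ‖(1 / 2 : ℂ)‖ < 1 := by norm_num
      have := hf.1 (coe_injective ((key 0).trans (key (mk _ h2)).symm))
      rw [← coe_inj] at this
      simp at this
    · intro s hs
      rw [isOpenEmbedding_unitDisc_coe.isOpen_iff_image_isOpen] at hs ⊢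
      have := h _ (by rintro _ ⟨z, -, rfl⟩; simpa using z.norm_lt_one) hs
      rw [Set.image_image] at this ⊢
      simpa only [discExtend_coe] using this
  have hcont : Continuous f := continuous_iff_continuousAt.2 fun z => (hol z).continuousAt
  let e : 𝔻 ≃ₜ 𝔻 := (Equiv.ofBijective f hf).toHomeomorphOfContinuousOpen hcont hopen
  have he : ∀ z, e z = f z := fun _ => rfl
  refine ⟨⟨e, fun z => hol z, fun w₀ => ?_⟩, fun _ => rfl⟩
  have hcont' : Continuous e.symm := e.symm.continuous
  have hF := analyticOnNhd_discExtend hol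
  -- The inverse is holomorphic wherever the derivative does not vanish.
  have good : ∀ z : 𝔻, deriv (discExtend f) z ≠ 0 → DiscHolomorphicAt e.symm (e z) := by
    intro z hz
    have ha : AnalyticAt ℂ (discExtend f) z := discHolomorphicAt_iff.1 (hol z)
    have hlin := ha.hasStrictDerivAt
    let R := ha.hasStrictDerivAt.localInverse (discExtend f) _ z hz
    have hRa : AnalyticAt ℂ R (e z : ℂ) := by
      have := ha.analyticAt_localInverse hz
      rwa [discExtend_coe] at this
    refine ⟨R, hRa, ?_⟩
    have hleft : ∀ᶠ w in 𝓝 (z : ℂ), R (discExtend f w) = w :=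
      hlin.eventually_left_inverse hz
    have h1 : ∀ᶠ w : 𝔻 in 𝓝 (e z), R (discExtend f (e.symm w)) = (e.symm w : ℂ) := by
      have : Filter.Tendsto (fun w : 𝔻 => ((e.symm w : 𝔻) : ℂ)) (𝓝 (e z)) (𝓝 (z : ℂ)) := by
        have := (continuous_coe.comp hcont').tendsto (e z)
        rwa [Function.comp_apply, e.symm_apply_apply] at this
      exact this.eventually hleft
    filter_upwards [h1] with w hw
    rw [discExtend_coe, ← he, e.apply_symm_apply] at hw
    exact hw.symm
  set z₀ := e.symm w₀ with hz₀
  -- Zeros of the derivative are isolated: otherwise `f` would be constant on a small ball about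
  -- `z₀`, against injectivity.
  have hpunct : ∀ᶠ z in 𝓝[≠] (z₀ : ℂ), deriv (discExtend f) z ≠ 0 := by
    refine (hF.deriv z₀ (by simpa using z₀.norm_lt_one)).eventually_eq_zero_or_eventually_ne_zero
      |>.resolve_left fun h0 => ?_
    obtain ⟨ε, hε, hball⟩ := Metric.eventually_nhds_iff_ball.1
      (h0.and (Metric.isOpen_ball.mem_nhds (by simpa using z₀.norm_lt_one :
        (z₀ : ℂ) ∈ Metric.ball (0 : ℂ) 1)))
    obtain ⟨c, hc⟩ := Metric.isOpen_ball.exists_is_const_of_deriv_eq_zero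
      (convex_ball (z₀ : ℂ) ε).isPreconnected
      (fun w hw => ((hF w (hball w hw).2).differentiableAt).differentiableWithinAt)
      (fun w hw => (hball w hw).1)
    have hmem : (z₀ : ℂ) + (ε / 2 : ℝ) ∈ Metric.ball (z₀ : ℂ) ε := by
      rw [mem_ball_iff_norm, add_sub_cancel_left, Complex.norm_real, Real.norm_eq_abs,
        abs_of_pos (by positivity)]
      linarith
    have hlt : ‖(z₀ : ℂ) + (ε / 2 : ℝ)‖ < 1 := by simpa using (hball _ hmem).2
    have h1 := hc _ hmem
    have h2 := hc _ (Metric.mem_ball_self hε)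
    have h3 : f (mk _ hlt) = f z₀ := by
      apply coe_injective
      exact (discExtend_coe f (mk _ hlt)).symm.trans (h1.trans (h2.symm.trans (discExtend_coe f z₀)))
    have h4 := congrArg ((↑) : 𝔻 → ℂ) (hf.1 h3)
    rw [coe_mk, add_eq_left, Complex.ofReal_eq_zero] at h4
    linarith
  have hinv : ∀ᶠ w : 𝔻 in 𝓝[≠] w₀, DiscHolomorphicAt e.symm w := by
    have ht : Filter.Tendsto (fun w : 𝔻 => ((e.symm w : 𝔻) : ℂ)) (𝓝[≠] w₀) (𝓝[≠] (z₀ : ℂ)) := by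
      refine tendsto_nhdsWithin_iff.2 ⟨?_, ?_⟩
      · exact ((continuous_coe.comp hcont').tendsto w₀).mono_left nhdsWithin_le_nhds
      · filter_upwards [self_mem_nhdsWithin] with w hw hw'
        exact hw (e.symm.injective (coe_injective hw'))
    filter_upwards [ht.eventually hpunct] with w hw
    simpa using good _ hw
  change DiscHolomorphicAt e.symm w₀
  rw [discHolomorphicAt_iff]
  -- Removable singularity: the inverse is continuous at `w₀` and holomorphic at the nearby points.
  refine Complex.analyticAt_of_differentiable_on_punctured_nhds_of_continuousAt ?_ ?_
  · rw [eventually_nhdsWithin_iff] at hinv ⊢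
    rw [← isOpenEmbedding_unitDisc_coe.map_nhds_eq, Filter.eventually_map]
    filter_upwards [hinv] with w hw hne
    exact (discHolomorphicAt_iff.1 (hw fun h => hne (congrArg _ h))).differentiableAt
  · refine isOpenEmbedding_unitDisc_coe.continuousAt_iff.1 ?_
    refine (continuous_coe.comp hcont').continuousAt.congr (Filter.Eventually.of_forall fun w => ?_)
    exact (discExtend_coe _ _).symm

/-! ### Automorphisms are Möbius transformations -/

open ComplexConjugate in
theorem normSq_one_sub_conj_mul_sub (z w : ℂ) :
    Complex.normSq (1 - conj w * z) - Complex.normSq (z - w) =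
      (1 - Complex.normSq z) * (1 - Complex.normSq w) := by
  simp only [Complex.normSq_apply, Complex.sub_re, Complex.sub_im, Complex.mul_re, Complex.mul_im,
    Complex.conj_re, Complex.conj_im, Complex.one_re, Complex.one_im]
  ring

open ComplexConjugate in
theorem one_sub_conj_mul_ne_zero {z w : ℂ} (hz : ‖z‖ < 1) (hw : ‖w‖ < 1) :
    1 - conj w * z ≠ 0 := by
  intro h
  have h1 : ‖conj w * z‖ < 1 := by
    rw [norm_mul, Complex.norm_conj]
    exact mul_lt_one_of_nonneg_of_lt_one_left (norm_nonneg _) hw hz.le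
  rw [← sub_eq_zero.1 h, norm_one] at h1
  exact lt_irrefl _ h1

open ComplexConjugate in
theorem norm_mobius_lt_one {z w : ℂ} (hz : ‖z‖ < 1) (hw : ‖w‖ < 1) :
    ‖(z - w) / (1 - conj w * z)‖ < 1 := by
  have h0 := one_sub_conj_mul_ne_zero hz hw
  rw [norm_div, div_lt_one (norm_pos_iff.2 h0), ← sq_lt_sq₀ (norm_nonneg _) (norm_nonneg _),
    ← Complex.normSq_eq_norm_sq, ← Complex.normSq_eq_norm_sq, ← sub_pos,
    normSq_one_sub_conj_mul_sub]
  have h1 : Complex.normSq z < 1 := by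
    rw [Complex.normSq_eq_norm_sq]; nlinarith [norm_nonneg z]
  have h2 : Complex.normSq w < 1 := by
    rw [Complex.normSq_eq_norm_sq]; nlinarith [norm_nonneg w]
  exact mul_pos (by linarith) (by linarith)

open ComplexConjugate in
theorem differentiableOn_mobius {f : ℂ → ℂ} (hf : DifferentiableOn ℂ f (Metric.ball 0 1))
    (hf1 : ∀ z ∈ Metric.ball (0 : ℂ) 1, ‖f z‖ < 1) {b : ℂ} (hb : ‖b‖ < 1) :
    DifferentiableOn ℂ (fun z => (f z - b) / (1 - conj b * f z)) (Metric.ball 0 1) :=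
  (hf.sub_const b).fun_div ((hf.const_mul _).const_sub 1) fun z hz =>
    one_sub_conj_mul_ne_zero (hf1 z hz) hb

open ComplexConjugate in
/-- Every automorphism of the disc has the form `z ↦ (c z + b) / (1 + b̄ c z)` with `|c| = 1`. -/
theorem DiscAut.exists_mobius (T : DiscAut) :
    ∃ (b : 𝔻) (c : ℂ), ‖c‖ = 1 ∧
      ∀ z : 𝔻, ((T • z : 𝔻) : ℂ) * (1 + conj (b : ℂ) * (c * z)) = c * z + b := by
  let b : 𝔻 := T • 0
  have hb := b.norm_lt_one
  have hnb : ‖-(b : ℂ)‖ < 1 := by rwa [norm_neg]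
  let F := discExtend (T • ·)
  let K := discExtend (T⁻¹ • ·)
  have hF : DifferentiableOn ℂ F (Metric.ball 0 1) :=
    (analyticOnNhd_discExtend (DiscAut.discHolomorphicAt T)).differentiableOn
  have hK : DifferentiableOn ℂ K (Metric.ball 0 1) :=
    (analyticOnNhd_discExtend (DiscAut.discHolomorphicAt T⁻¹)).differentiableOn
  have hF1 : ∀ z, ‖F z‖ < 1 := norm_discExtend_lt_one _
  have hFc : ∀ z : 𝔻, F z = (T • z : 𝔻) := discExtend_coe _
  have hKc : ∀ z : 𝔻, K z = (T⁻¹ • z : 𝔻) := discExtend_coe _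
  let f : ℂ → ℂ := fun z => (F z - b) / (1 - conj (b : ℂ) * F z)
  let m : ℂ → ℂ := fun w => (w - -(b : ℂ)) / (1 - conj (-(b : ℂ)) * w)
  have hfd : DifferentiableOn ℂ f (Metric.ball 0 1) :=
    differentiableOn_mobius hF (fun z _ => hF1 z) hb
  have hf1 : ∀ z, ‖f z‖ < 1 := fun z => norm_mobius_lt_one (hF1 z) hb
  have hf0 : f 0 = 0 := by
    have : F 0 = b := hFc 0
    simp [f, this]
  have hm1 : ∀ w ∈ Metric.ball (0 : ℂ) 1, ‖m w‖ < 1 := fun w hw =>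
    norm_mobius_lt_one (by simpa using hw) hnb
  have hmd : DifferentiableOn ℂ m (Metric.ball 0 1) :=
    differentiableOn_mobius differentiableOn_id (fun z hz => by simpa using hz) hnb
  have hgd : DifferentiableOn ℂ (fun w => K (m w)) (Metric.ball 0 1) :=
    hK.comp hmd fun w hw => by simpa using hm1 w hw
  have hg0 : K (m 0) = 0 := by
    have h1 : m 0 = (b : ℂ) := by simp [m]
    rw [h1, hKc, inv_smul_smul]
    rfl
  have hmf : ∀ z, m (f z) = F z := by
    intro z
    have h1 : 1 - conj (b : ℂ) * F z ≠ 0 := one_sub_conj_mul_ne_zero (hF1 z) hb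
    have h2 : 1 - conj (-(b : ℂ)) * f z ≠ 0 := one_sub_conj_mul_ne_zero (hf1 z) hnb
    have h3 : f z * (1 - conj (b : ℂ) * F z) = F z - b := div_mul_cancel₀ _ h1
    simp only [m]
    rw [div_eq_iff h2, map_neg]
    linear_combination h3
  -- Schwarz lemma for `f` and for its inverse `K ∘ m`, both fixing `0`.
  have hnorm : ∀ z : ℂ, ‖z‖ < 1 → ‖f z‖ = ‖z‖ := by
    intro z hz
    refine le_antisymm (Complex.norm_le_norm_of_mapsTo_ball hfd
      (fun w _ => by simpa using (hf1 w).le) hf0 hz) ?_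
    have h1 := Complex.norm_le_norm_of_mapsTo_ball hgd
      (fun w _ => by simpa using (norm_discExtend_lt_one _ _).le) hg0 (hf1 z)
    have h2 : K (F z) = z := by
      have := hFc (mk z hz)
      rw [coe_mk] at this
      rw [this, hKc, inv_smul_smul, coe_mk]
    simpa only [hmf, h2] using h1
  -- Equality in the Schwarz lemma at one nonzero point, here `1/2`, makes `f` a rotation.
  obtain ⟨c, hc, hfc⟩ := Complex.affine_of_mapsTo_ball_of_exists_norm_dslope_eq_div' (f := f)
    (c := 0) (R₁ := 1) (R₂ := 1) hfd (fun w _ => by simpa [hf0] using (hf1 w).le)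
    ⟨1 / 2, by norm_num, by
      rw [dslope_of_ne _ (by norm_num), slope_def_module, hf0, sub_zero, sub_zero, norm_smul,
        hnorm _ (by norm_num)]
      norm_num⟩
  refine ⟨b, c, by simpa using hc, fun z => ?_⟩
  have hz : (z : ℂ) ∈ Metric.ball (0 : ℂ) 1 := by simpa using z.norm_lt_one
  have h1 := hfc hz
  simp only [hf0, zero_add, sub_zero, smul_eq_mul] at h1
  have h2 := hmf z
  rw [h1, hFc] at h2
  have h3 : 1 - conj (-(b : ℂ)) * (z * c) ≠ 0 := by
    rw [← h1]
    exact one_sub_conj_mul_ne_zero (hf1 z) hnb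
  simp only [m] at h2
  rw [div_eq_iff h3, map_neg] at h2
  linear_combination -h2

/-! ### The pseudo-hyperbolic distance -/

open ComplexConjugate in
/-- The points of the disc at pseudo-hyperbolic distance less than `√ε`. -/
def PseudoHyperbolicLT (ε : ℝ) (z w : 𝔻) : Prop :=
  Complex.normSq (z - w : ℂ) < ε * Complex.normSq (1 - conj (w : ℂ) * z)

open ComplexConjugate in
theorem isOpen_pseudoHyperbolicLT (ε : ℝ) :
    IsOpen {p : 𝔻 × 𝔻 | PseudoHyperbolicLT ε p.1 p.2} := by
  have h1 : Continuous fun p : 𝔻 × 𝔻 => (p.1 : ℂ) := continuous_coe.comp continuous_fst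
  have h2 : Continuous fun p : 𝔻 × 𝔻 => (p.2 : ℂ) := continuous_coe.comp continuous_snd
  exact isOpen_lt (Complex.continuous_normSq.comp (h1.sub h2))
    (continuous_const.mul (Complex.continuous_normSq.comp
      (continuous_const.sub ((Complex.continuous_conj.comp h2).mul h1))))

open ComplexConjugate in
theorem pseudoHyperbolicLT_self {ε : ℝ} (hε : 0 < ε) (z : 𝔻) : PseudoHyperbolicLT ε z z := by
  rw [PseudoHyperbolicLT, sub_self, map_zero]
  exact mul_pos hε (Complex.normSq_pos.2
    (one_sub_conj_mul_ne_zero z.norm_lt_one z.norm_lt_one))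

-- In the Möbius form of `T`, passing to images multiplies `|z - w|` and `|1 - w̄z|` by the same
-- factor `(1 - |b|²) / (|p||q|)`, where `p` and `q` are the denominators at `z` and `w`; this is
-- `e1` and `e2`.
open ComplexConjugate in
theorem PseudoHyperbolicLT.smul {ε : ℝ} {z w : 𝔻} (h : PseudoHyperbolicLT ε z w) (T : DiscAut) :
    PseudoHyperbolicLT ε (T • z) (T • w) := by
  obtain ⟨b, c, hc, hT⟩ := DiscAut.exists_mobius T
  have hne : ∀ z : 𝔻, 1 + conj (b : ℂ) * (c * z) ≠ 0 := by
    intro z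
    have := one_sub_conj_mul_ne_zero (z := c * z) (w := -(b : ℂ))
      (by rw [norm_mul, hc, one_mul]; exact z.norm_lt_one) (by rw [norm_neg]; exact b.norm_lt_one)
    simpa using this
  have hTz := hT z
  have hTw := hT w
  set u : ℂ := ((T • z : 𝔻) : ℂ)
  set v : ℂ := ((T • w : 𝔻) : ℂ)
  set p : ℂ := 1 + conj (b : ℂ) * (c * z)
  set q : ℂ := 1 + conj (b : ℂ) * (c * w)
  have hcc : conj c * c = 1 := by
    rw [mul_comm, Complex.mul_conj, Complex.normSq_eq_norm_sq, hc]; norm_num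
  have hTw' : conj v * conj q = conj c * conj (w : ℂ) + conj (b : ℂ) := by
    rw [← map_mul, hTw]; simp
  have e1 : (u - v) * (p * q) = (1 - conj (b : ℂ) * b) * (c * (z - w)) := by
    simp only [p, q] at *
    linear_combination hTz * (1 + conj (b : ℂ) * (c * w)) - hTw * (1 + conj (b : ℂ) * (c * z))
  have e2 : (1 - conj v * u) * (p * conj q) =
      (1 - conj (b : ℂ) * b) * (1 - conj (w : ℂ) * z) := by
    have hq : conj q = 1 + b * (conj c * conj (w : ℂ)) := by simp [q]
    have : (1 - conj v * u) * (p * conj q) = p * conj q - (conj v * conj q) * (u * p) := by ring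
    rw [this, hTw', hTz, hq]
    simp only [p]
    linear_combination (conj (b : ℂ) * b * z * conj (w : ℂ) - z * conj (w : ℂ)) * hcc
  have n1 := congrArg Complex.normSq e1
  have n2 := congrArg Complex.normSq e2
  have nc : Complex.normSq c = 1 := by rw [Complex.normSq_eq_norm_sq, hc]; norm_num
  simp only [map_mul, Complex.normSq_conj, nc, one_mul] at n1 n2
  have hp := Complex.normSq_pos.2 (hne z)
  have hq := Complex.normSq_pos.2 (hne w)
  have hB : 0 < Complex.normSq (1 - conj (b : ℂ) * b) :=
    Complex.normSq_pos.2 (one_sub_conj_mul_ne_zero b.norm_lt_one b.norm_lt_one)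
  have hpq := mul_pos hp hq
  unfold PseudoHyperbolicLT at h ⊢
  refine lt_of_mul_lt_mul_right ?_ hpq.le
  change Complex.normSq (u - v) * (Complex.normSq p * Complex.normSq q) <
    ε * Complex.normSq (1 - conj v * u) * (Complex.normSq p * Complex.normSq q)
  rw [n1, mul_assoc, n2]
  calc _ < Complex.normSq (1 - conj (b : ℂ) * b) * (ε * Complex.normSq (1 - conj (w : ℂ) * z)) :=
        mul_lt_mul_of_pos_left h hB
    _ = _ := by ring

-- The identity `|1 - w̄z|² = |z - w|² + (1 - |z|²)(1 - |w|²)` lets `|z - w|²` be absorbed on the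
-- left. The point is that the bound tends to `0` as `w` approaches the unit circle.
open ComplexConjugate in
theorem PseudoHyperbolicLT.normSq_sub_le {ε : ℝ} (hε : ε < 1) {z w : 𝔻}
    (h : PseudoHyperbolicLT ε z w) :
    Complex.normSq (z - w : ℂ) ≤ (1 - ε)⁻¹ * (1 - Complex.normSq w) := by
  unfold PseudoHyperbolicLT at h
  have h1 := normSq_one_sub_conj_mul_sub z w
  have hz := z.normSq_lt_one
  have hw := w.normSq_lt_one
  have h0 := Complex.normSq_nonneg (z : ℂ)
  have h2 : (1 - Complex.normSq (z : ℂ)) * (1 - Complex.normSq (w : ℂ)) ≤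
      1 - Complex.normSq (w : ℂ) := by nlinarith
  have h3 : 0 ≤ Complex.normSq (1 - conj (w : ℂ) * z) := Complex.normSq_nonneg _
  have h4 := Complex.normSq_nonneg (z - w : ℂ)
  have h5 : 0 < ε := pos_of_mul_pos_left (h4.trans_lt h) h3
  rw [inv_mul_eq_div, le_div_iff₀ (by linarith)]
  have h6 : ε * Complex.normSq (1 - conj (w : ℂ) * z) ≤
      ε * (Complex.normSq (z - w : ℂ) + (1 - Complex.normSq (w : ℂ))) :=
    mul_le_mul_of_nonneg_left (by linarith) h5.le
  nlinarith

/-- An automorphism of the disc with bounded displacement is the identity. -/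
theorem DiscAut.eq_one_of_forall_pseudoHyperbolicLT {ε : ℝ} (hε : ε < 1) {T : DiscAut}
    (h : ∀ z : 𝔻, PseudoHyperbolicLT ε (T • z) z) : T = 1 := by
  refine DiscAut.ext_smul fun z => coe_injective ?_
  rw [one_smul, ← sub_eq_zero, ← norm_eq_zero, ← sq_eq_zero_iff]
  have hF : DifferentiableOn ℂ (fun w => discExtend (T • ·) w - w) (Metric.ball 0 1) :=
    (analyticOnNhd_discExtend (DiscAut.discHolomorphicAt T)).differentiableOn.sub differentiableOn_id
  -- Maximum principle for `T w - w` on the disc of radius `r`; letting `r → 1` makes it vanish.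
  have key : ∀ᶠ r : ℝ in 𝓝[<] 1, ‖((T • z : 𝔻) : ℂ) - z‖ ^ 2 ≤ (1 - ε)⁻¹ * (1 - r ^ 2) := by
    filter_upwards [Ioo_mem_nhdsLT z.norm_lt_one] with r hr
    have hr0 : 0 < r := (norm_nonneg _).trans_lt hr.1
    have hC : 0 ≤ (1 - ε)⁻¹ * (1 - r ^ 2) :=
      mul_nonneg (inv_nonneg.2 (by linarith)) (by nlinarith [hr.2])
    have hsub : closure (Metric.ball (0 : ℂ) r) ⊆ Metric.ball 0 1 := by
      rw [closure_ball _ hr0.ne']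
      exact Metric.closedBall_subset_ball hr.2
    have := Complex.norm_le_of_forall_mem_frontier_norm_le (U := Metric.ball (0 : ℂ) r)
      Metric.isBounded_ball (hF.mono hsub).diffContOnCl
      (C := √((1 - ε)⁻¹ * (1 - r ^ 2))) (fun w hw => ?_)
      (subset_closure (by simpa using hr.1 : (z : ℂ) ∈ Metric.ball (0 : ℂ) r))
    · rw [discExtend_coe] at this
      rwa [← Real.le_sqrt (norm_nonneg _) hC]
    · rw [frontier_ball _ hr0.ne', mem_sphere_zero_iff_norm] at hw
      have hw1 : ‖w‖ < 1 := hw.trans_lt hr.2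
      have := (h (mk w hw1)).normSq_sub_le hε
      rw [coe_mk, Complex.normSq_eq_norm_sq, Complex.normSq_eq_norm_sq, hw] at this
      refine Real.le_sqrt_of_sq_le ?_
      have e := discExtend_coe (T • ·) (mk w hw1)
      rw [coe_mk] at e
      rwa [e]
  refine le_antisymm (ge_of_tendsto (f := fun r : ℝ => (1 - ε)⁻¹ * (1 - r ^ 2)) ?_ key) (sq_nonneg _)
  have : Continuous fun r : ℝ => (1 - ε)⁻¹ * (1 - r ^ 2) := by fun_prop
  have := (this.tendsto 1).mono_left (nhdsWithin_le_nhds (s := Set.Iio 1))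
  simpa using this

/-! ### Cocompact actions -/

section Cocompact

variable {Γ X : Type*} [Group Γ] [TopologicalSpace X] [MulAction Γ X] [ContinuousConstSMul Γ X]
  [LocallyCompactSpace X]

/-- The translates of some compact set cover a space with compact quotient. -/
theorem exists_isCompact_forall_exists_smul_mem
    (h : CompactSpace (Quotient (MulAction.orbitRel Γ X))) :
    ∃ K : Set X, IsCompact K ∧ ∀ x : X, ∃ g : Γ, g • x ∈ K := by
  choose C hC hCx using fun x : X => exists_compact_mem_nhds x
  have hopen : ∀ x, IsOpen ((Quotient.mk (MulAction.orbitRel Γ X)) '' interior (C x)) := fun x =>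
    isOpenMap_quotient_mk'_mul _ isOpen_interior
  obtain ⟨t, ht⟩ := isCompact_univ.elim_finite_subcover _ hopen (by
    intro q _
    obtain ⟨x, rfl⟩ := Quotient.exists_rep q
    exact Set.mem_iUnion.2 ⟨x, x, mem_interior_iff_mem_nhds.2 (hCx x), rfl⟩)
  refine ⟨⋃ x ∈ t, C x, t.isCompact_biUnion fun x _ => hC x, fun x => ?_⟩
  obtain ⟨y, hy, u, hu, hux⟩ := Set.mem_iUnion₂.1 (ht (Set.mem_univ (Quotient.mk _ x)))
  obtain ⟨g, hg⟩ := MulAction.orbitRel_apply.1 (Quotient.exact hux)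
  exact ⟨g, Set.mem_iUnion₂.2 ⟨y, hy, by simpa only [hg] using interior_subset hu⟩⟩

/-- A group acting properly discontinuously and cocompactly on a connected space is finitely
generated. -/
theorem group_fg_of_cocompact [ConnectedSpace X] [ProperlyDiscontinuousSMul Γ X]
    (h : CompactSpace (Quotient (MulAction.orbitRel Γ X))) : Group.FG Γ := by
  obtain ⟨K, hK, hcov⟩ := exists_isCompact_forall_exists_smul_mem h
  obtain ⟨L, hL, hKL⟩ := exists_compact_superset hK
  -- Translates of `L` that meet differ by an element of `S`. Hence the translates of `interior L`
  -- by `H` and by its complement form two disjoint open sets covering `X`, and connectedness forces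
  -- `H` to be everything.
  let S : Set Γ := {g | ((g • ·) '' L ∩ L).Nonempty}
  have hS : S.Finite := ProperlyDiscontinuousSMul.finite_disjoint_inter_image hL hL
  let H := Subgroup.closure S
  let A : Set X := ⋃ g ∈ H, (g • ·) '' interior L
  let B : Set X := ⋃ g ∈ (H : Set Γ)ᶜ, (g • ·) '' interior L
  have hA : IsOpen A := isOpen_biUnion fun g _ => isOpenMap_smul g _ isOpen_interior
  have hB : IsOpen B := isOpen_biUnion fun g _ => isOpenMap_smul g _ isOpen_interior
  have hmem : ∀ x : X, ∃ g : Γ, x ∈ (g • ·) '' interior L := fun x => by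
    obtain ⟨g, hg⟩ := hcov x
    exact ⟨g⁻¹, g • x, hKL hg, inv_smul_smul g x⟩
  have hdisj : ∀ g g' : Γ, ∀ x, x ∈ (g • ·) '' interior L → x ∈ (g' • ·) '' interior L →
      g ∈ H → g' ∈ H := by
    rintro g g' _ ⟨u, hu, rfl⟩ ⟨v, hv, hvu⟩ hg
    have : g⁻¹ * g' ∈ S := by
      refine ⟨u, ⟨v, interior_subset hv, ?_⟩, interior_subset hu⟩
      simp only [mul_smul] at hvu ⊢
      rw [hvu, inv_smul_smul]
    simpa using H.mul_mem hg (Subgroup.subset_closure this)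
  have hAB : Aᶜ = B := by
    ext x
    constructor
    · intro hx
      obtain ⟨g, hg⟩ := hmem x
      exact Set.mem_iUnion₂.2 ⟨g, fun hgH => hx (Set.mem_iUnion₂.2 ⟨g, hgH, hg⟩), hg⟩
    · rintro hx hxA
      obtain ⟨g, hg, hgx⟩ := Set.mem_iUnion₂.1 hx
      obtain ⟨g', hg', hgx'⟩ := Set.mem_iUnion₂.1 hxA
      exact hg (hdisj _ _ _ hgx' hgx hg')
  have hAuniv : A = Set.univ := by
    refine (isClopen_iff.1 ⟨⟨hAB ▸ hB⟩, hA⟩).resolve_left ?_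
    obtain ⟨x⟩ := (inferInstance : Nonempty X)
    obtain ⟨g, u, hu, -⟩ := hmem x
    exact Set.Nonempty.ne_empty ⟨u, Set.mem_iUnion₂.2 ⟨1, H.one_mem, u, hu, one_smul _ _⟩⟩
  refine Group.fg_iff.2 ⟨S, (Subgroup.eq_top_iff' _).2 fun g => ?_, hS⟩
  obtain ⟨x⟩ := (inferInstance : Nonempty X)
  obtain ⟨g₀, u, hu, -⟩ := hmem x
  have : g • u ∈ A := hAuniv ▸ Set.mem_univ _
  obtain ⟨g', hg', hgx'⟩ := Set.mem_iUnion₂.1 this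
  exact hdisj _ _ _ hgx' ⟨u, hu, rfl⟩ hg'

end Cocompact

/-! ### Residual finiteness -/

/-- If `x` lies in the Jacobson radical then `x² + 1` is a unit, so `x = 0`; nonzero primes are
maximal. -/
theorem isJacobsonRing_int : IsJacobsonRing ℤ := by
  rw [isJacobsonRing_iff_prime_eq]
  intro P hP
  by_cases hbot : P = ⊥
  · subst hbot
    refine le_antisymm (fun x hx => ?_) Ideal.le_jacobson
    have h := Ideal.mem_jacobson_bot.1 hx x
    rw [Int.isUnit_iff] at h
    rw [Ideal.mem_bot]
    rcases h with h | h <;> nlinarith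
  · have := Ring.DimensionLEOne.maximalOfPrime hbot hP
    exact Ideal.jacobson_eq_self_of_isMaximal

/-- A field which is finitely generated as a ring is finite. -/
theorem finite_of_finiteType_int (F : Type*) [Field F] [Algebra.FiniteType ℤ F] : Finite F := by
  have := isJacobsonRing_int
  -- Zariski's lemma over a Jacobson ring. Characteristic zero is then impossible, since `F`
  -- integral over `ℤ` would make `ℤ` a field.
  have hfin : Module.Finite ℤ F := finite_of_finite_type_of_isJacobsonRing ℤ F
  obtain ⟨p, hp⟩ := CharP.exists F
  rcases eq_or_ne p 0 with rfl | hp0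
  · exfalso
    have := CharP.charP_to_charZero F
    have hint : Algebra.IsIntegral ℤ F := inferInstance
    exact Int.not_isField (isField_of_isIntegral_of_isField
      (FaithfulSMul.algebraMap_injective ℤ F) (Field.toIsField F))
  · have : NeZero p := ⟨hp0⟩
    let _ : Algebra (ZMod p) F := ZMod.algebra F p
    have : Module.Finite (ZMod p) F := Module.Finite.of_restrictScalars_finite ℤ (ZMod p) F
    exact Module.finite_of_finite (ZMod p)

theorem finite_quotient_of_finiteType_int (A : Type*) [CommRing A] [Algebra.FiniteType ℤ A]
    (m : Ideal A) [m.IsMaximal] : Finite (A ⧸ m) := by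
  have h : Algebra.FiniteType ℤ (A ⧸ m) :=
    Algebra.FiniteType.of_surjective (Ideal.Quotient.mkₐ ℤ m) Ideal.Quotient.mk_surjective
  refine @finite_of_finiteType_int (A ⧸ m) (Ideal.Quotient.field m) ?_
  convert! h

theorem Matrix.mem_range_scalar_fin_two_iff {R : Type*} [CommRing R]
    (M : Matrix (Fin 2) (Fin 2) R) :
    M ∈ Set.range (Matrix.scalar (Fin 2)) ↔ M 0 1 = 0 ∧ M 1 0 = 0 ∧ M 0 0 - M 1 1 = 0 := by
  constructor
  · rintro ⟨r, rfl⟩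
    simp
  · rintro ⟨h1, h2, h3⟩
    refine ⟨M 0 0, ?_⟩
    ext i j
    fin_cases i <;> fin_cases j <;> simp [h1, h2, sub_eq_zero.1 h3]

/-- A finitely generated subgroup of `PGL₂` of a field is residually finite: if `ρ` is
a representation of a free group of finite rank by invertible matrices, and if the kernel of
a surjective homomorphism `π` consists of the elements represented by scalar matrices, then the
image of `π` is residually finite. -/
theorem residuallyFinite_of_projective_representation {Γ K S : Type} [Group Γ] [Field K] [Finite S]
    (ρ : FreeGroup S →* Matrix.GeneralLinearGroup (Fin 2) K) (π : FreeGroup S →* Γ)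
    (hπ : Function.Surjective π)
    (hker : ∀ p, π p = 1 ↔ ρ p ∈ Subgroup.center (Matrix.GeneralLinearGroup (Fin 2) K)) :
    Group.ResiduallyFinite Γ := by
  refine Group.residuallyFinite_of_forall_exists_finite_monoidHom fun g hg => ?_
  obtain ⟨p, rfl⟩ := hπ g
  have hp : ρ p ∉ Subgroup.center (Matrix.GeneralLinearGroup (Fin 2) K) := fun h =>
    hg ((hker p).2 h)
  -- The three obstructions to being scalar; one of them, `x`, is nonzero at `ρ p`.
  let e : Matrix (Fin 2) (Fin 2) K → Fin 3 → K := fun M => ![M 0 1, M 1 0, M 0 0 - M 1 1]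
  obtain ⟨i₀, hi₀⟩ : ∃ i, e (ρ p).1 i ≠ 0 := by
    by_contra! h
    refine hp (Matrix.GeneralLinearGroup.mem_center_iff_val_mem_range_scalar.2 ?_)
    exact (Matrix.mem_range_scalar_fin_two_iff _).2 ⟨h 0, h 1, h 2⟩
  let x := e (ρ p).1 i₀
  -- Malcev's argument: over the ring generated by the entries of the generators and their inverses,
  -- reduce modulo a maximal ideal, whose residue field is finite. Adjoining `x⁻¹` makes `x` a unit,
  -- so `ρ p` stays nonscalar.
  let E : Set K := insert x⁻¹ ((Set.range fun q : S × Fin 2 × Fin 2 =>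
    (ρ (FreeGroup.of q.1)).1 q.2.1 q.2.2) ∪ Set.range fun q : S × Fin 2 × Fin 2 =>
    (ρ (FreeGroup.of q.1))⁻¹.1 q.2.1 q.2.2)
  have hE : E.Finite := ((Set.finite_range _).union (Set.finite_range _)).insert _
  let A : Subalgebra ℤ K := Algebra.adjoin ℤ E
  have hA : Algebra.FiniteType ℤ A :=
    A.fg_iff_finiteType.1 (Subalgebra.fg_def.2 ⟨E, hE, rfl⟩)
  have hxA : x⁻¹ ∈ A := Algebra.subset_adjoin (Set.mem_insert _ _)
  let incl : A →+* K := A.val.toRingHom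
  have hincl : Function.Injective incl := Subtype.val_injective
  have hinclM : Function.Injective fun M : Matrix (Fin 2) (Fin 2) A => M.map incl :=
    Matrix.map_injective hincl
  let gen : S → Matrix.GeneralLinearGroup (Fin 2) A := fun s =>
    ⟨Matrix.of fun i j => ⟨(ρ (FreeGroup.of s)).1 i j, Algebra.subset_adjoin
        (Set.mem_insert_of_mem _ (Or.inl ⟨(s, i, j), rfl⟩))⟩,
      Matrix.of fun i j => ⟨(ρ (FreeGroup.of s))⁻¹.1 i j, Algebra.subset_adjoin
        (Set.mem_insert_of_mem _ (Or.inr ⟨(s, i, j), rfl⟩))⟩,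
      hinclM (by
        have := (ρ (FreeGroup.of s)).mul_inv
        simp only [Matrix.map_mul]
        rw [Matrix.map_one _ (map_zero _) (map_one _)]
        exact this),
      hinclM (by
        have := (ρ (FreeGroup.of s)).inv_mul
        simp only [Matrix.map_mul]
        rw [Matrix.map_one _ (map_zero _) (map_one _)]
        exact this)⟩
  let ρA : FreeGroup S →* Matrix.GeneralLinearGroup (Fin 2) A := FreeGroup.lift gen
  have hρA : (Matrix.GeneralLinearGroup.map incl).comp ρA = ρ := by
    refine FreeGroup.ext_hom _ _ fun s => ?_
    rw [MonoidHom.comp_apply, FreeGroup.lift_apply_of]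
    exact Units.ext rfl
  have hρA' : ∀ q i j, incl ((ρA q).1 i j) = (ρ q).1 i j := fun q i j => by
    rw [← hρA]; rfl
  obtain ⟨m, hm⟩ := Ideal.exists_maximal A
  have hfin : Finite (A ⧸ m) := finite_quotient_of_finiteType_int A m
  let red := Matrix.GeneralLinearGroup.map (n := Fin 2) (Ideal.Quotient.mk m)
  let Q := Matrix.GeneralLinearGroup (Fin 2) (A ⧸ m) ⧸
    Subgroup.center (Matrix.GeneralLinearGroup (Fin 2) (A ⧸ m))
  let f : FreeGroup S →* Q := (QuotientGroup.mk' _).comp (red.comp ρA)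
  have hf : ∀ q, f q = 1 ↔ (red (ρA q)).1 ∈ Set.range (Matrix.scalar (Fin 2)) := fun q => by
    rw [← Matrix.GeneralLinearGroup.mem_center_iff_val_mem_range_scalar]
    exact QuotientGroup.eq_one_iff _
  have hle : π.ker ≤ f.ker := by
    intro q hq
    have h1 := Matrix.GeneralLinearGroup.mem_center_iff_val_mem_range_scalar.1 ((hker q).1 hq)
    rw [Matrix.mem_range_scalar_fin_two_iff] at h1
    rw [MonoidHom.mem_ker, hf, Matrix.mem_range_scalar_fin_two_iff]
    simp only [← hρA', ← map_sub] at h1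
    have h2 : ∀ a : A, incl a = 0 → Ideal.Quotient.mk m a = 0 := fun a ha => by
      rw [hincl (ha.trans (map_zero incl).symm), map_zero]
    exact ⟨h2 _ h1.1, h2 _ h1.2.1, by
      rw [← h2 _ h1.2.2, map_sub]; rfl⟩
  refine ⟨Q, inferInstance, inferInstance, MonoidHom.liftOfSurjective π hπ ⟨f, hle⟩, ?_⟩
  have : MonoidHom.liftOfSurjective π hπ ⟨f, hle⟩ (π p) = f p :=
    MonoidHom.liftOfRightInverse_comp_apply _ _ _ ⟨f, hle⟩ p
  rw [this, Ne, hf, Matrix.mem_range_scalar_fin_two_iff]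
  intro h
  let xA : A := ![(ρA p).1 0 1, (ρA p).1 1 0, (ρA p).1 0 0 - (ρA p).1 1 1] i₀
  have hxA1 : incl xA = x := by
    simp only [xA, x, e]
    fin_cases i₀ <;> simp [hρA']
  have hxA0 : Ideal.Quotient.mk m xA = 0 := by
    simp only [xA]
    fin_cases i₀
    · exact h.1
    · exact h.2.1
    · exact (map_sub (Ideal.Quotient.mk m) _ _).trans h.2.2
  have hunit : xA * ⟨x⁻¹, hxA⟩ = 1 := hincl (by
    rw [map_mul, hxA1, map_one]
    exact mul_inv_cancel₀ hi₀)
  have := congrArg (Ideal.Quotient.mk m) hunit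
  rw [map_mul, hxA0, zero_mul, map_one] at this
  exact zero_ne_one this

/-- The matrix `M` acts on the disc as the Möbius transformation `T`. -/
def Matrix.InducesDiscAut (M : Matrix (Fin 2) (Fin 2) ℂ) (T : DiscAut) : Prop :=
  ∀ z : 𝔻, ∃ c : ℂ, M.mulVec ![(z : ℂ), 1] = c • ![((T • z : 𝔻) : ℂ), 1]

theorem Matrix.InducesDiscAut.mul {M N : Matrix (Fin 2) (Fin 2) ℂ} {S T : DiscAut}
    (hM : M.InducesDiscAut S) (hN : N.InducesDiscAut T) : (M * N).InducesDiscAut (S * T) := by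
  intro z
  obtain ⟨c, hc⟩ := hN z
  obtain ⟨d, hd⟩ := hM (T • z)
  exact ⟨c * d, by rw [← Matrix.mulVec_mulVec, hc, Matrix.mulVec_smul, hd, smul_smul]; rfl⟩

theorem Matrix.InducesDiscAut.inv {M : Matrix.GeneralLinearGroup (Fin 2) ℂ} {T : DiscAut}
    (hM : M.1.InducesDiscAut T) : (M⁻¹).1.InducesDiscAut T⁻¹ := by
  intro z
  obtain ⟨c, hc⟩ := hM (T⁻¹ • z)
  rw [smul_inv_smul] at hc
  have h1 := congrArg (M⁻¹).1.mulVec hc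
  rw [Matrix.mulVec_mulVec, M.inv_mul, Matrix.one_mulVec, Matrix.mulVec_smul] at h1
  have hc0 : c ≠ 0 := by
    rintro rfl
    have := congrFun h1 1
    simp at this
  exact ⟨c⁻¹, by rw [h1, smul_smul, inv_mul_cancel₀ hc0, one_smul]⟩

theorem Matrix.InducesDiscAut.one : (1 : Matrix (Fin 2) (Fin 2) ℂ).InducesDiscAut 1 := fun z =>
  ⟨1, by simp⟩

theorem Matrix.InducesDiscAut.eq_one_iff {M : Matrix (Fin 2) (Fin 2) ℂ} {T : DiscAut}
    (hM : M.InducesDiscAut T) (hdet : M ≠ 0) :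
    T = 1 ↔ M ∈ Set.range (Matrix.scalar (Fin 2)) := by
  have key : ∀ z : 𝔻, M 0 0 * z + M 0 1 = (T • z : 𝔻) * (M 1 0 * z + M 1 1) := by
    intro z
    obtain ⟨c, hc⟩ := hM z
    have h0 := congrFun hc 0
    have h1 := congrFun hc 1
    simp [Matrix.mulVec, dotProduct, Fin.sum_univ_two] at h0 h1
    rw [h0, h1, mul_comm]
  rw [Matrix.mem_range_scalar_fin_two_iff]
  constructor
  · rintro rfl
    simp only [one_smul] at key
    -- The quadratic polynomial `M₁₀z² + (M₁₁ - M₀₀)z - M₀₁` vanishes on the disc; three points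
    -- suffice to kill its coefficients.
    have h0 := key 0
    have h1 := key (mk (1 / 2) (by norm_num))
    have h2 := key (mk (-1 / 2) (by norm_num))
    simp only [coe_zero, coe_mk] at h0 h1 h2
    refine ⟨by linear_combination h0, ?_, ?_⟩
    · linear_combination 4 * h0 - 2 * h1 - 2 * h2
    · linear_combination h1 - h2
  · rintro ⟨h1, h2, h3⟩
    refine DiscAut.ext_smul fun z => coe_injective ?_
    have hk := key z
    rw [h1, h2, sub_eq_zero.1 h3] at hk
    have h4 : M 1 1 ≠ 0 := by
      intro h4
      refine hdet ?_
      ext i j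
      fin_cases i <;> fin_cases j <;> simp [h1, h2, h4, sub_eq_zero.1 h3]
    rw [one_smul]
    refine mul_left_cancel₀ h4 ?_
    linear_combination -hk

open ComplexConjugate in
theorem DiscAut.exists_induces (T : DiscAut) :
    ∃ M : Matrix.GeneralLinearGroup (Fin 2) ℂ, M.1.InducesDiscAut T := by
  obtain ⟨b, c, hc, h⟩ := DiscAut.exists_mobius T
  have hdet : (!![c, (b : ℂ); conj (b : ℂ) * c, 1] : Matrix (Fin 2) (Fin 2) ℂ).det ≠ 0 := by
    rw [Matrix.det_fin_two_of, show c * 1 - b * (conj (b : ℂ) * c) = c * (1 - conj (b : ℂ) * b) by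
      ring]
    exact mul_ne_zero (norm_ne_zero_iff.1 (by rw [hc]; exact one_ne_zero))
      (one_sub_conj_mul_ne_zero b.norm_lt_one b.norm_lt_one)
  refine ⟨Matrix.GeneralLinearGroup.mkOfDetNeZero _ hdet, fun z => ⟨1 + conj (b : ℂ) * (c * z), ?_⟩⟩
  ext i
  have := h z
  fin_cases i
  · simp [Matrix.GeneralLinearGroup.mkOfDetNeZero, Matrix.mulVec, dotProduct, Fin.sum_univ_two]
    linear_combination -this
  · simp [Matrix.GeneralLinearGroup.mkOfDetNeZero, Matrix.mulVec, dotProduct, Fin.sum_univ_two]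
    ring

/-- Finitely generated groups of automorphisms of the disc are residually finite. -/
theorem residuallyFinite_of_fg (G : Subgroup DiscAut) (hG : Group.FG G) :
    Group.ResiduallyFinite G := by
  obtain ⟨S, hS, hfin⟩ := Group.fg_iff.1 hG
  have := hfin.to_subtype
  choose M hM using fun s : S => DiscAut.exists_induces (s : G)
  -- The chosen matrices are only determined up to scalars and need not respect the relations of
  -- `G`, hence the free group.
  let ρ : FreeGroup S →* Matrix.GeneralLinearGroup (Fin 2) ℂ := FreeGroup.lift M
  let π : FreeGroup S →* G := FreeGroup.lift Subtype.val
  have hπ : Function.Surjective π := by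
    rw [← MonoidHom.range_eq_top, FreeGroup.range_lift_eq_closure, Subtype.range_coe, hS]
  have hind : ∀ p, (ρ p).1.InducesDiscAut (π p : G) := by
    intro p
    induction p using FreeGroup.induction_on with
    | C1 => simpa using Matrix.InducesDiscAut.one
    | of s => simpa [ρ, π] using hM s
    | inv_of s h =>
      rw [map_inv, map_inv]
      exact h.inv
    | mul p q hp hq =>
      rw [map_mul, map_mul]
      exact hp.mul hq
  refine residuallyFinite_of_projective_representation ρ π hπ fun p => ?_
  rw [Matrix.GeneralLinearGroup.mem_center_iff_val_mem_range_scalar,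
    ← (hind p).eq_one_iff (ρ p).ne_zero, OneMemClass.coe_eq_one]

/-! ### The profinite completion -/

theorem Subgroup.finiteIndex_comap {G G' : Type*} [Group G] [Group G'] (f : G →* G')
    (H : Subgroup G') [H.FiniteIndex] : (H.comap f).FiniteIndex := by
  refine ⟨?_⟩
  rw [Subgroup.index_comap]
  exact fun h => H.index_ne_zero_of_finite (H.index_eq_zero_of_relIndex_eq_zero h)

section ProfiniteHat

variable {G : Type} [Group G]

theorem denseRange_toProfiniteHat (G : Type) [Group G] : DenseRange (toProfiniteHat G) :=
  ProfiniteGrp.ProfiniteCompletion.denseRange (GrpCat.of G)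

theorem toProfiniteHat_injective (h : Group.ResiduallyFinite G) :
    Function.Injective (toProfiniteHat G) :=
  (ProfiniteGrp.ProfiniteCompletion.etaFn_injective_iff_residuallyFinite (GrpCat.of G)).2 h

instance : ContinuousConstSMul G (ProfiniteHat G) := ⟨fun _ => continuous_const_mul _⟩

/-- Subgroups of finite index are open in the profinite topology. -/
theorem exists_isOpen_of_finiteIndex (H : Subgroup G) [H.FiniteIndex] :
    ∃ W : Set (ProfiniteHat G), IsOpen W ∧ 1 ∈ W ∧ ∀ g, toProfiniteHat G g ∈ W → g ∈ H := by
  let M : FiniteIndexNormalSubgroup (GrpCat.of G) :=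
    FiniteIndexNormalSubgroup.ofSubgroup H.normalCore
  let π := (ProfiniteGrp.limitCone (ProfiniteGrp.ProfiniteCompletion.diagram (GrpCat.of G))).π.app M
  have hπ : Continuous π.hom := π.hom.continuous_toFun
  refine ⟨π.hom ⁻¹' {1}, ?_, map_one π.hom, fun g hg => ?_⟩
  · have : DiscreteTopology ((ProfiniteGrp.ProfiniteCompletion.diagram (GrpCat.of G)).obj M) :=
      ⟨rfl⟩
    exact (isOpen_discrete _).preimage hπ
  · exact H.normalCore_le ((QuotientGroup.eq_one_iff g).1 hg)

/-- Neighbourhoods of `1` in the profinite completion contain the image of a subgroup of finite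
index. -/
theorem exists_finiteIndex_of_mem_nhds {V : Set (ProfiniteHat G)} (hV : V ∈ 𝓝 1) :
    ∃ N : Subgroup G, N.FiniteIndex ∧ ∀ g ∈ N, toProfiniteHat G g ∈ V := by
  obtain ⟨U, hUV, hU, h1⟩ := mem_nhds_iff.1 hV
  obtain ⟨O, hO⟩ := ProfiniteGrp.exist_openNormalSubgroup_sub_open_nhds_of_one hU h1
  have : O.toSubgroup.FiniteIndex := Subgroup.finiteIndex_of_finite_quotient
  exact ⟨O.toSubgroup.comap (toProfiniteHat G), Subgroup.finiteIndex_comap _ _, fun g hg => hUV (hO hg)⟩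

/-- The universal property of the profinite completion. -/
theorem exists_profiniteHat_lift {G' : Type} [Group G'] (φ : G →* ProfiniteHat G') :
    ∃ ψ : ProfiniteHat G →* ProfiniteHat G', Continuous ψ ∧ ∀ g, ψ (toProfiniteHat G g) = φ g := by
  let L := ProfiniteGrp.ProfiniteCompletion.lift (G := GrpCat.of G)
    (P := ProfiniteGrp.ProfiniteCompletion.completion (GrpCat.of G')) (GrpCat.ofHom φ)
  refine ⟨L.hom.toMonoidHom, L.hom.continuous_toFun, fun g => ?_⟩
  exact CategoryTheory.ConcreteCategory.congr_hom (ProfiniteGrp.ProfiniteCompletion.lift_eta (G := GrpCat.of G)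
    (P := ProfiniteGrp.ProfiniteCompletion.completion (GrpCat.of G')) (GrpCat.ofHom φ)) g

/-- The extension of the inclusion of a subgroup of finite index to profinite completions is an open
embedding, whose image intersects the group in the subgroup. -/
theorem profiniteHat_finiteIndex (H : Subgroup G) [H.FiniteIndex]
    {j : ProfiniteHat H →* ProfiniteHat G} (hj : Continuous j)
    (hjH : ∀ h : H, j (toProfiniteHat H h) = toProfiniteHat G h) :
    Topology.IsOpenEmbedding j ∧ (∀ g, toProfiniteHat G g ∈ Set.range j → g ∈ H) ∧
      ∀ a : ProfiniteHat G, ∃ g : G, toProfiniteHat G g * a ∈ Set.range j := by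
  have hinj : Function.Injective j := by
    rw [injective_iff_map_eq_one]
    intro a ha
    by_contra hne
    obtain ⟨O, hO⟩ := ProfiniteGrp.exist_openNormalSubgroup_sub_open_nhds_of_one
      (isOpen_compl_singleton (x := a)) (Ne.symm hne)
    have hOfin : O.toSubgroup.FiniteIndex := Subgroup.finiteIndex_of_finite_quotient
    let M : Subgroup H := O.toSubgroup.comap (toProfiniteHat H)
    have hMfin : M.FiniteIndex := Subgroup.finiteIndex_comap _ _
    -- A finite-index subgroup of `H` has finite index in `G`, so `G` induces on `H` its full
    -- profinite topology. An `h ∈ H` near `a`, with image near `j a = 1`, must lie in `M`, forcing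
    -- `a ∈ O`.
    let M' : Subgroup G := M.map H.subtype
    have hM' : M'.FiniteIndex := by
      refine ⟨?_⟩
      rw [Subgroup.index_map_subtype]
      exact mul_ne_zero Subgroup.FiniteIndex.index_ne_zero Subgroup.FiniteIndex.index_ne_zero
    obtain ⟨W, hW, hW1, hWM⟩ := exists_isOpen_of_finiteIndex M'
    have hopen : IsOpen ({b | a⁻¹ * b ∈ O.toSubgroup} ∩ j ⁻¹' W) :=
      (O.isOpen'.preimage (continuous_const_mul a⁻¹)).inter (hW.preimage hj)
    obtain ⟨h, hh1, hh2⟩ := (denseRange_toProfiniteHat H).exists_mem_open hopen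
      ⟨a, by simp, by rwa [Set.mem_preimage, ha]⟩
    rw [Set.mem_preimage, hjH] at hh2
    obtain ⟨m, hm, hmh⟩ := hWM _ hh2
    have hmh' : m = h := Subtype.ext hmh
    subst hmh'
    have : a ∈ O.toSubgroup := by
      have := O.toSubgroup.mul_mem hm (O.toSubgroup.inv_mem hh1)
      simpa using this
    exact hO this rfl
  have hclosed : Topology.IsClosedEmbedding j := hj.isClosedEmbedding hinj
  obtain ⟨W, hW, hW1, hWH⟩ := exists_isOpen_of_finiteIndex H
  -- The elements of `G` in `W` lie in `H` and are dense in `W`, so the closed range contains `W`.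
  have hopen : IsOpen (Set.range j) := by
    refine j.range.isOpen_of_mem_nhds (g := 1) (Filter.mem_of_superset (hW.mem_nhds hW1) ?_)
    intro a ha
    refine hclosed.isClosed_range.closure_subset_iff.2 ?_
      ((denseRange_toProfiniteHat G).open_subset_closure_inter hW ha)
    rintro _ ⟨hgW, g, rfl⟩
    exact ⟨toProfiniteHat H ⟨g, hWH g hgW⟩, hjH _⟩
  refine ⟨⟨hclosed.isEmbedding, hopen⟩, ?_, fun a => ?_⟩
  · rintro g ⟨a, ha⟩
    obtain ⟨h, hh⟩ := (denseRange_toProfiniteHat H).exists_mem_open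
      (s := {b | (toProfiniteHat G g)⁻¹ * j b ∈ W})
      (hW.preimage (continuous_const.mul hj)) ⟨a, by simpa [ha] using hW1⟩
    rw [Set.mem_ofPred_eq, hjH, ← map_inv, ← map_mul] at hh
    have := H.mul_mem h.2 (H.inv_mem (hWH _ hh))
    simpa using this
  · obtain ⟨g, hg⟩ := (denseRange_toProfiniteHat G).exists_mem_open
      (hopen.preimage (continuous_mul_const a)) ⟨a⁻¹, 1, by simp⟩
    exact ⟨g, hg⟩

end ProfiniteHat

/-! ### The solenoid -/

instance (G : Subgroup DiscAut) : ContinuousConstSMul G 𝔻 :=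
  ⟨fun g => DiscAut.continuous_smul g⟩

namespace Solenoid

variable (G : Subgroup DiscAut)

theorem continuous_proj : Continuous fun p : 𝔻 × ProfiniteHat G => proj G p.1 p.2 :=
  continuous_quotient_mk'

theorem isOpenMap_proj : IsOpenMap fun p : 𝔻 × ProfiniteHat G => proj G p.1 p.2 :=
  isOpenMap_quotient_mk'_mul

variable {G}

theorem proj_eq_iff {z w : 𝔻} {a b : ProfiniteHat G} :
    proj G z a = proj G w b ↔ ∃ g : G, g • w = z ∧ toProfiniteHat G g * b = a := by
  refine Quotient.eq.trans (MulAction.orbitRel_apply.trans ?_)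
  exact exists_congr fun g => Prod.mk_inj

theorem proj_smul (g : G) (z : 𝔻) (a : ProfiniteHat G) :
    proj G (g • z) (toProfiniteHat G g * a) = proj G z a :=
  proj_eq_iff.2 ⟨g, rfl, rfl⟩

theorem exists_proj (x : Solenoid G) : ∃ z a, proj G z a = x := by
  obtain ⟨⟨z, a⟩, h⟩ := Quotient.exists_rep x
  exact ⟨z, a, h⟩

theorem proj_toProfiniteHat (z : 𝔻) (g : G) :
    proj G z (toProfiniteHat G g) = proj G (g⁻¹ • z) 1 := by
  rw [← proj_smul g (g⁻¹ • z) 1, smul_inv_smul, mul_one]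

theorem t2Space (hG : UniformizesCompactSurface G) : T2Space (Solenoid G) := by
  have := hG.properlyDiscontinuous
  have : ProperlyDiscontinuousSMul G (𝔻 × ProfiniteHat G) := by
    refine ⟨fun {K L} hK hL => ?_⟩
    refine (ProperlyDiscontinuousSMul.finite_disjoint_inter_image (Γ := G)
      (hK.image continuous_fst) (hL.image continuous_fst)).subset ?_
    rintro g ⟨_, ⟨k, hk, rfl⟩, hl⟩
    exact ⟨g • k.1, ⟨k.1, ⟨k, hk, rfl⟩, rfl⟩, ⟨_, hl, rfl⟩⟩
  exact inferInstanceAs (T2Space (Quotient (MulAction.orbitRel G (𝔻 × ProfiniteHat G))))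

/-- The base leaf is dense: continuous maps are determined by their restrictions to it. -/
theorem ext_baseLeaf {Y : Type*} [TopologicalSpace Y] [T2Space Y] {f g : Solenoid G → Y}
    (hf : Continuous f) (hg : Continuous g) (h : ∀ z, f (proj G z 1) = g (proj G z 1)) :
    f = g := by
  funext x
  obtain ⟨z, a, rfl⟩ := exists_proj x
  have hc : Continuous fun a => proj G z a := (continuous_proj G).comp (Continuous.prodMk_right z)
  refine congrFun ((denseRange_toProfiniteHat G).equalizer (hf.comp hc) (hg.comp hc) ?_) a
  -- Elements of `G` are dense in `Ĝ`, and `[z, γ] = [γ⁻¹z, 1]` is on the base leaf.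
  funext γ
  simp only [Function.comp_apply, proj_toProfiniteHat, h]

theorem proj_one_injective (hG : Group.ResiduallyFinite G) :
    Function.Injective fun z => proj G z 1 := by
  intro z w h
  obtain ⟨g, rfl, hg⟩ := proj_eq_iff.1 h
  rw [mul_one] at hg
  rw [toProfiniteHat_injective hG (hg.trans (map_one _).symm), one_smul]

end Solenoid

theorem UniformizesCompactSurface.residuallyFinite {G : Subgroup DiscAut}
    (hG : UniformizesCompactSurface G) : Group.ResiduallyFinite G := by
  have := hG.properlyDiscontinuous
  exact residuallyFinite_of_fg G (group_fg_of_cocompact (X := 𝔻) hG.compact_quotient)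

/-! ### The action of the commensurator -/

section Commensurator

variable {Γ : Type*} [Group Γ]

/-- The subgroup of all `h ∈ G` such that `γ h γ⁻¹ ∈ G`. -/
def Subgroup.conjMem (G : Subgroup Γ) (γ : Γ) : Subgroup G :=
  (G.comap (MulAut.conj γ).toMonoidHom).subgroupOf G

theorem Subgroup.mem_conjMem {G : Subgroup Γ} {γ : Γ} {h : G} :
    h ∈ G.conjMem γ ↔ γ * h * γ⁻¹ ∈ G := Iff.rfl

open Pointwise in
theorem Subgroup.finiteIndex_conjMem_inv_iff {G : Subgroup Γ} {γ : Γ} :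
    (G.conjMem γ⁻¹).FiniteIndex ↔ (ConjAct.toConjAct γ • G).relIndex G ≠ 0 := by
  have : G.comap (MulAut.conj γ⁻¹).toMonoidHom = ConjAct.toConjAct γ • G := by
    ext x
    rw [Subgroup.mem_pointwise_smul_iff_inv_smul_mem, Subgroup.mem_comap, ← ConjAct.toConjAct_inv,
      ConjAct.toConjAct_smul]
    rfl
  rw [Subgroup.conjMem, this, Subgroup.finiteIndex_iff, Subgroup.relIndex]

-- Conjugation by `γ⁻¹` turns the index of `G ∩ γGγ⁻¹` in `γGγ⁻¹` into that of `G ∩ γ⁻¹Gγ` in `G`,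
-- so both conditions concern subgroups of `G`.
open Pointwise in
theorem Subgroup.mem_commensurator_iff_finiteIndex {G : Subgroup Γ} {γ : Γ} :
    γ ∈ Subgroup.Commensurable.commensurator G ↔
      (G.conjMem γ).FiniteIndex ∧ (G.conjMem γ⁻¹).FiniteIndex := by
  have h1 := Subgroup.finiteIndex_conjMem_inv_iff (G := G) (γ := γ)
  have h2 := Subgroup.finiteIndex_conjMem_inv_iff (G := G) (γ := γ⁻¹)
  rw [inv_inv] at h2
  rw [Subgroup.Commensurable.commensurator_mem_iff, Subgroup.Commensurable, h1, h2, and_comm,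
    ConjAct.toConjAct_inv,
    ← Subgroup.relIndex_pointwise_smul (ConjAct.toConjAct γ)⁻¹ G (ConjAct.toConjAct γ • G),
    inv_smul_smul]

/-- Conjugation by `γ` as a homomorphism from its natural domain of definition in `G` to `G`. -/
def Subgroup.conjMemHom (G : Subgroup Γ) (γ : Γ) : G.conjMem γ →* G where
  toFun h := ⟨γ * h * γ⁻¹, h.2⟩
  map_one' := by ext; simp
  map_mul' x y := by ext; simp

end Commensurator

namespace Solenoid

variable {G : Subgroup DiscAut}

/-- An automorphism `γ` of the disc for which `G ∩ γ⁻¹ G γ` has finite index in `G` extends from the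
base leaf to a holomorphic map of the solenoid. -/
theorem exists_isHolomorphic_extension (γ : DiscAut) (hγ : (G.conjMem γ).FiniteIndex) :
    ∃ Φ : Solenoid G → Solenoid G, IsHolomorphic Φ ∧
      ∀ z, Φ (proj G z 1) = proj G (γ • z) 1 := by
  obtain ⟨j, hj, hjH⟩ :=
    exists_profiniteHat_lift ((toProfiniteHat G).comp (G.conjMem γ).subtype)
  obtain ⟨k, hk, hkH⟩ := exists_profiniteHat_lift ((toProfiniteHat G).comp (G.conjMemHom γ))
  obtain ⟨hopen, hmem, hcov⟩ := profiniteHat_finiteIndex (G.conjMem γ) hj hjH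
  let π : 𝔻 × ProfiniteHat (G.conjMem γ) → Solenoid G := fun p => proj G p.1 (j p.2)
  let Θ : 𝔻 × ProfiniteHat (G.conjMem γ) → Solenoid G := fun p => proj G (γ • p.1) (k p.2)
  have hπc : Continuous π :=
    (continuous_proj G).comp (continuous_fst.prodMk (hj.comp continuous_snd))
  have hΘc : Continuous Θ := (continuous_proj G).comp
    (((DiscAut.continuous_smul γ).comp continuous_fst).prodMk (hk.comp continuous_snd))
  have hπo : IsOpenMap π := (isOpenMap_proj G).comp (IsOpenMap.id.prodMap hopen.isOpenMap)
  have hchart : ∀ a : ProfiniteHat G, ∃ (g : G) (b : ProfiniteHat (G.conjMem γ)),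
      ∀ z, proj G z a = π (g • z, b) := by
    intro a
    obtain ⟨g, b, hb⟩ := hcov a
    exact ⟨g, b, fun z => by rw [← proj_smul g z a, ← hb]⟩
  have hπs : Function.Surjective π := by
    intro x
    obtain ⟨z, a, rfl⟩ := exists_proj x
    obtain ⟨g, b, h⟩ := hchart a
    exact ⟨_, (h z).symm⟩
  have hfib : ∀ p q, π p = π q → Θ p = Θ q := by
    rintro ⟨z, a⟩ ⟨w, b⟩ h
    obtain ⟨g, rfl, hg⟩ := proj_eq_iff.1 h
    -- An element of `G` relating two points of `Δ × Ĥ` lies in the range of `j`, hence in `H`; so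
    -- conjugation by `γ` is defined on it.
    have hgH : g ∈ G.conjMem γ := hmem g ⟨a * b⁻¹, by
      rw [map_mul, map_inv, ← hg, mul_inv_cancel_right]⟩
    lift g to G.conjMem γ using hgH
    have hab : toProfiniteHat _ g * b = a := hopen.injective (by
      rw [map_mul, hjH]; exact hg)
    refine proj_eq_iff.2 ⟨G.conjMemHom γ g, ?_, ?_⟩
    · change (γ * (g : G) * γ⁻¹ : DiscAut) • γ • w = γ • ((g : G) : DiscAut) • w
      simp only [smul_smul, inv_mul_cancel_right]
    · change toProfiniteHat G (G.conjMemHom γ g) * k b = k a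
      rw [← hab, map_mul, hkH]
      rfl
  obtain ⟨s, hs⟩ := hπs.hasRightInverse
  have hcomp : ∀ p, Θ (s (π p)) = Θ p := fun p => hfib _ _ (hs _)
  refine ⟨Θ ∘ s, ⟨?_, fun z₀ a => ?_⟩, fun z => ?_⟩
  · rw [(hπo.isQuotientMap hπc hπs).continuous_iff]
    exact hΘc.congr fun p => (hcomp p).symm
  · obtain ⟨g, b, h⟩ := hchart a
    refine ⟨fun z => (γ * g : DiscAut) • z, k b, DiscAut.discHolomorphicAt _ _,
      Filter.Eventually.of_forall fun z => ?_⟩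
    rw [Function.comp_apply, h, hcomp]
    simp only [Θ, mul_smul]
    rfl
  · have h : proj G z 1 = π (z, 1) := by simp only [π, map_one]
    rw [Function.comp_apply, h, hcomp]
    simp only [Θ, map_one]

/-- Every element of the commensurator of `G` extends from the base leaf to a holomorphic
self-homeomorphism of the solenoid. -/
theorem exists_homeomorph_extension (hG : UniformizesCompactSurface G) (γ : ComAut G) :
    ∃ Φ : Solenoid G ≃ₜ Solenoid G, IsHolomorphic Φ ∧
      ∀ z, Φ (proj G z 1) = proj G (γ • z) 1 := by
  have := t2Space hG
  have hγ := Subgroup.mem_commensurator_iff_finiteIndex.1 γ.2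
  obtain ⟨Φ, hΦ, h⟩ := exists_isHolomorphic_extension (γ : DiscAut) hγ.1
  obtain ⟨Ψ, hΨ, h'⟩ := exists_isHolomorphic_extension (γ : DiscAut)⁻¹ hγ.2
  have h1 : Ψ ∘ Φ = id := ext_baseLeaf (hΨ.1.comp hΦ.1) continuous_id fun z => by
    simp [h, h']
  have h2 : Φ ∘ Ψ = id := ext_baseLeaf (hΦ.1.comp hΨ.1) continuous_id fun z => by
    simp [h, h']
  exact ⟨⟨⟨Φ, Ψ, congrFun h1, congrFun h2⟩, hΦ.1, hΨ.1⟩, hΦ, h⟩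

end Solenoid

/-! ### Homeomorphisms preserving the base leaf -/

open ComplexConjugate in
theorem PseudoHyperbolicLT.dist_lt {ε δ : ℝ} (hδ : 0 < δ) (hε : ε ≤ δ ^ 2 / 4) {z w : 𝔻}
    (h : PseudoHyperbolicLT ε z w) : dist (z : ℂ) w < δ := by
  have h1 : ‖1 - conj (w : ℂ) * z‖ ≤ 2 := by
    have : ‖conj (w : ℂ) * z‖ ≤ 1 := by
      rw [norm_mul, Complex.norm_conj]
      exact mul_le_one₀ w.norm_lt_one.le (norm_nonneg _) z.norm_lt_one.le
    calc ‖1 - conj (w : ℂ) * z‖ ≤ ‖(1 : ℂ)‖ + ‖conj (w : ℂ) * z‖ := norm_sub_le _ _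
      _ ≤ 2 := by rw [norm_one]; linarith
  rw [PseudoHyperbolicLT, Complex.normSq_eq_norm_sq, Complex.normSq_eq_norm_sq] at h
  have h2 : ‖1 - conj (w : ℂ) * z‖ ^ 2 ≤ 4 := by nlinarith [norm_nonneg (1 - conj (w : ℂ) * z)]
  rw [dist_eq_norm, ← sq_lt_sq₀ (norm_nonneg _) hδ.le]
  nlinarith [sq_nonneg ‖1 - conj (w : ℂ) * z‖]

/-- A uniform lower bound for the injectivity radius of `Δ / G`. -/
theorem UniformizesCompactSurface.exists_pseudoHyperbolicLT_imp_eq_one {G : Subgroup DiscAut}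
    (hG : UniformizesCompactSurface G) :
    ∃ ε : ℝ, 0 < ε ∧ ε < 1 ∧ ∀ (g : G) (w u : 𝔻),
      PseudoHyperbolicLT ε w u → PseudoHyperbolicLT ε (g • w) u → g = 1 := by
  have := hG.properlyDiscontinuous
  obtain ⟨K, hK, hcov⟩ := exists_isCompact_forall_exists_smul_mem hG.compact_quotient
  choose U hU hUg using ProperlyDiscontinuousSMul.exists_nhds_image_smul_eq_self G (T := 𝔻)
  obtain ⟨δ, hδ, hball⟩ := lebesgue_number_lemma_of_metric (hK.image continuous_coe)
    (c := fun x => ((↑) : 𝔻 → ℂ) '' interior (U x))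
    (fun x => isOpenEmbedding_unitDisc_coe.isOpenMap _ isOpen_interior) (by
      rintro _ ⟨x, -, rfl⟩
      exact Set.mem_iUnion.2 ⟨x, x, mem_interior_iff_mem_nhds.2 (hU x), rfl⟩)
  -- Here `δ` is a Lebesgue number on `K`. The bound `|1 - w̄z| ≤ 2` gives `δ²/4`, and `1/2` keeps
  -- `ε < 1`. Invariance allows `u` to be moved into `K`.
  refine ⟨min (δ ^ 2 / 4) (1 / 2), by positivity, (min_le_right _ _).trans_lt (by norm_num),
    fun g w u hw hgw => ?_⟩
  obtain ⟨g₀, hg₀⟩ := hcov u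
  obtain ⟨x, hx⟩ := hball _ ⟨_, hg₀, rfl⟩
  have hmem : ∀ v : 𝔻, PseudoHyperbolicLT (min (δ ^ 2 / 4) (1 / 2)) v u → g₀ • v ∈ U x := by
    intro v hv
    have h : PseudoHyperbolicLT (min (δ ^ 2 / 4) (1 / 2)) (g₀ • v) (g₀ • u) := hv.smul g₀
    obtain ⟨y, hy, hyv⟩ := hx (Metric.mem_ball.2 (h.dist_lt hδ (min_le_left _ _)))
    exact coe_injective hyv ▸ interior_subset hy
  have h1 : g₀ * g * g₀⁻¹ = 1 := hG.free _ x (hUg x _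
    ⟨g₀ • g • w, ⟨g₀ • w, hmem w hw, by simp [mul_smul]⟩, hmem _ hgw⟩)
  rw [mul_inv_eq_one, mul_eq_left] at h1
  exact h1

namespace Solenoid

variable {G : Subgroup DiscAut}

/-- If a continuous map of the solenoid restricts to `γ` on the base leaf, then `γ n⁻¹` is close to
`γ` modulo `G`, uniformly on the disc, for all `n` in some subgroup of finite index. -/
theorem exists_finiteIndex_forall_pseudoHyperbolicLT (hG : UniformizesCompactSurface G)
    {Φ : Solenoid G → Solenoid G} (hΦ : Continuous Φ) {γ : DiscAut}
    (hγ : ∀ z, Φ (proj G z 1) = proj G (γ • z) 1) {ε : ℝ} (hε : 0 < ε) :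
    ∃ N : Subgroup G, N.FiniteIndex ∧ ∀ n ∈ N, ∀ z : 𝔻, ∃ h : G,
      PseudoHyperbolicLT ε (h • γ • n⁻¹ • z) (γ • z) := by
  let P : 𝔻 × ProfiniteHat G → Solenoid G := fun p => proj G p.1 p.2
  let E : Set (Solenoid G × Solenoid G) := Prod.map P P '' {q | PseudoHyperbolicLT ε q.1.1 q.2.1}
  have hE : IsOpen E := (isOpenMap_proj G).prodMap (isOpenMap_proj G) _
    ((isOpen_pseudoHyperbolicLT ε).preimage
      (f := fun q : (𝔻 × ProfiniteHat G) × (𝔻 × ProfiniteHat G) => (q.1.1, q.2.1)) (by fun_prop))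
  have hrefl : ∀ x, (x, x) ∈ E := by
    intro x
    obtain ⟨z, a, rfl⟩ := exists_proj x
    exact ⟨((z, a), (z, a)), pseudoHyperbolicLT_self hε z, rfl⟩
  obtain ⟨K, hK, hcov⟩ := exists_isCompact_forall_exists_smul_mem hG.compact_quotient
  have hO : IsOpen {q : (𝔻 × ProfiniteHat G) × ProfiniteHat G |
      (Φ (proj G q.1.1 (q.1.2 * q.2)), Φ (proj G q.1.1 q.1.2)) ∈ E} := by
    refine hE.preimage (Continuous.prodMk (hΦ.comp ?_) (hΦ.comp ?_))
    · exact (continuous_proj G).comp (Continuous.prodMk (continuous_fst.comp continuous_fst)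
        ((continuous_snd.comp continuous_fst).mul continuous_snd))
    · exact (continuous_proj G).comp continuous_fst
  -- Uniform continuity under right translation in `Ĝ`, from compactness of `K × Ĝ`. Right
  -- translation commutes with the left action of `G`, so control over `K` gives control over all of
  -- `Δ`, and `[z, n] = [n⁻¹z, 1]`.
  obtain ⟨V₀, V, -, hV, hKV₀, h1V, hVO⟩ := generalized_tube_lemma
    (hK.prod (isCompact_univ (X := ProfiniteHat G))) (isCompact_singleton (x := 1)) hO (by
      rintro ⟨p, c⟩ ⟨-, rfl⟩
      simp only [Set.mem_ofPred_eq, mul_one]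
      exact hrefl _)
  obtain ⟨N, hN, hNV⟩ :=
    exists_finiteIndex_of_mem_nhds (hV.mem_nhds (h1V (Set.mem_singleton 1)))
  refine ⟨N, hN, fun n hn z => ?_⟩
  obtain ⟨g, hg⟩ := hcov z
  have hmem := hVO (Set.mk_mem_prod (hKV₀ (Set.mk_mem_prod hg (Set.mem_univ (toProfiniteHat G g))))
    (hNV n hn))
  simp only [Set.mem_ofPred_eq, proj_smul] at hmem
  have e : proj G (g • z) (toProfiniteHat G g) = proj G z 1 := by
    rw [← proj_smul g z 1, mul_one]
  rw [e, proj_toProfiniteHat, hγ, hγ] at hmem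
  obtain ⟨⟨⟨x, a⟩, ⟨y, b⟩⟩, hxy, hq⟩ := hmem
  obtain ⟨h1, h2⟩ := Prod.mk.inj hq
  obtain ⟨g₁, rfl, -⟩ := proj_eq_iff.1 h1
  obtain ⟨g₂, rfl, -⟩ := proj_eq_iff.1 h2
  refine ⟨g₂⁻¹ * g₁, ?_⟩
  have h3 : PseudoHyperbolicLT ε (g₂⁻¹ • g₁ • γ • n⁻¹ • z) (g₂⁻¹ • g₂ • γ • z) :=
    PseudoHyperbolicLT.smul hxy (g₂⁻¹ : G)
  rwa [inv_smul_smul, smul_smul] at h3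

/-- If a continuous map of the solenoid restricts to `γ` on the base leaf, then `G ∩ γ⁻¹ G γ` has
finite index in `G`. -/
theorem finiteIndex_conjMem_of_continuous (hG : UniformizesCompactSurface G)
    {Φ : Solenoid G → Solenoid G} (hΦ : Continuous Φ) {γ : DiscAut}
    (hγ : ∀ z, Φ (proj G z 1) = proj G (γ • z) 1) : (G.conjMem γ).FiniteIndex := by
  obtain ⟨ε, hε, hε1, hinj⟩ := hG.exists_pseudoHyperbolicLT_imp_eq_one
  obtain ⟨N, hN, hNε⟩ := exists_finiteIndex_forall_pseudoHyperbolicLT hG hΦ hγ hε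
  refine Subgroup.finiteIndex_of_le (H := N) fun n hn => ?_
  choose h hh using hNε n hn
  have hcont : Continuous fun z : 𝔻 => γ • z := DiscAut.continuous_smul γ
  have hcont' : ∀ g : G, Continuous fun z : 𝔻 => g • γ • n⁻¹ • z := fun g =>
    (continuous_const_smul g).comp (hcont.comp (continuous_const_smul _))
  -- The value `h z` still works at nearby `y`, and the injectivity radius leaves only one possible
  -- value there.
  have hloc : IsLocallyConstant h := by
    rw [IsLocallyConstant.iff_eventually_eq]
    intro z
    have hopen : IsOpen {y : 𝔻 | PseudoHyperbolicLT ε (h z • γ • n⁻¹ • y) (γ • y)} :=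
      (isOpen_pseudoHyperbolicLT ε).preimage ((hcont' _).prodMk hcont)
    filter_upwards [hopen.mem_nhds (hh z)] with y hy
    have := hinj (h y * (h z)⁻¹) _ _ hy (by
      rw [smul_smul, inv_mul_cancel_right]
      exact hh y)
    exact mul_inv_eq_one.1 this
  have hconst : ∀ z, h z = h 0 := fun z => hloc.apply_eq_of_preconnectedSpace z 0
  have key : ((h 0 : G) : DiscAut) * (γ * ((n⁻¹ : G) : DiscAut) * γ⁻¹) = 1 := by
    refine DiscAut.eq_one_of_forall_pseudoHyperbolicLT hε1 fun z => ?_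
    have := hh (γ⁻¹ • z)
    rw [hconst, smul_inv_smul] at this
    simp only [mul_smul]
    exact this
  rw [Subgroup.mem_conjMem]
  have : γ * (n : DiscAut) * γ⁻¹ = ((h 0 : G) : DiscAut) := by
    rw [mul_eq_one_iff_eq_inv.1 key, Subgroup.coe_inv]
    group
  rw [this]
  exact (h 0).2

/-- A holomorphic self-homeomorphism of the solenoid preserving the base leaf acts on it through an
element of the commensurator of `G`. -/
theorem exists_comAut_of_isHolomorphic (hG : UniformizesCompactSurface G)
    (Φ : Solenoid G ≃ₜ Solenoid G) (hΦ : IsHolomorphic Φ)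
    (hleaf : Φ '' baseLeaf G = baseLeaf G) :
    ∃ γ : ComAut G, ∀ z, Φ (proj G z 1) = proj G (γ • z) 1 := by
  have hinj := proj_one_injective hG.residuallyFinite
  have hex : ∀ z, ∃ w, proj G w 1 = Φ (proj G z 1) := fun z => by
    have : Φ (proj G z 1) ∈ baseLeaf G := hleaf ▸ ⟨_, ⟨z, rfl⟩, rfl⟩
    exact this
  choose f hf using hex
  have hbij : Function.Bijective f := by
    constructor
    · intro z w h
      exact hinj (Φ.injective ((hf z).symm.trans (h ▸ hf w)))
    · intro w
      have : proj G w 1 ∈ Φ '' baseLeaf G := by rw [hleaf]; exact ⟨w, rfl⟩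
      obtain ⟨_, ⟨z, rfl⟩, hz⟩ := this
      exact ⟨z, hinj ((hf z).trans hz)⟩
  have hhol : ∀ z, DiscHolomorphicAt f z := by
    intro z₀
    obtain ⟨ψ, b, hψ, h⟩ := hΦ.2 z₀ 1
    -- At `z₀` this gives `g b = 1` in `Ĝ`, so the leaf label `b` comes from `G` and `f = gψ` near
    -- `z₀`.
    obtain ⟨g, -, hg⟩ := proj_eq_iff.1 ((hf z₀).trans h.self_of_nhds)
    have hgψ : DiscHolomorphicAt (fun z => ((g : G) : DiscAut) • ψ z) z₀ :=
      (DiscAut.discHolomorphicAt (g : DiscAut) (ψ z₀)).comp hψ hψ.continuousAt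
    refine hgψ.congr ?_
    filter_upwards [h] with z hz
    refine hinj ?_
    change proj G (g • ψ z) 1 = proj G (f z) 1
    rw [hf, hz, ← hg, proj_smul]
  obtain ⟨γ, hγ⟩ := exists_discAut_of_bijective hbij hhol
  have h1 : ∀ z, Φ (proj G z 1) = proj G (γ • z) 1 := fun z => by rw [hγ, hf]
  have h2 : ∀ z, Φ.symm (proj G z 1) = proj G (γ⁻¹ • z) 1 := fun z => by
    rw [Homeomorph.symm_apply_eq, h1, smul_inv_smul]
  exact ⟨⟨γ, Subgroup.mem_commensurator_iff_finiteIndex.2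
    ⟨finiteIndex_conjMem_of_continuous hG hΦ.1 h1,
      finiteIndex_conjMem_of_continuous hG Φ.symm.continuous h2⟩⟩, h1⟩

end Solenoid

/-- For `X = Δ/G` compact hyperbolic, there is exactly one homomorphism `ρ` from `ComAut(X)` to the
group of self-homeomorphisms of `H_∞(X) = Δ ×_G Ĝ` for which `ρ γ` restricts to `γ` on the base
leaf; it is injective, and its image consists of all holomorphic self-homeomorphisms that preserve
the base leaf. -/
theorem proposition4p12 (G : Subgroup DiscAut) (hG : UniformizesCompactSurface G) :
    ∃ ρ : ComAut G →* (Solenoid G ≃ₜ Solenoid G),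
      (∀ (γ : ComAut G) (z : 𝔻), ρ γ (Solenoid.proj G z 1) = Solenoid.proj G (γ • z) 1) ∧
      (∀ ρ' : ComAut G →* (Solenoid G ≃ₜ Solenoid G),
        (∀ (γ : ComAut G) (z : 𝔻), ρ' γ (Solenoid.proj G z 1) = Solenoid.proj G (γ • z) 1) →
          ρ' = ρ) ∧
      Function.Injective ρ ∧
      Set.range ρ = {Φ : Solenoid G ≃ₜ Solenoid G |
        Solenoid.IsHolomorphic Φ ∧ Φ '' Solenoid.baseLeaf G = Solenoid.baseLeaf G} := by
  have := Solenoid.t2Space hG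
  have hext : ∀ Φ Ψ : Solenoid G ≃ₜ Solenoid G,
      (∀ z, Φ (Solenoid.proj G z 1) = Ψ (Solenoid.proj G z 1)) → Φ = Ψ := fun Φ Ψ h =>
    Homeomorph.ext (congrFun (Solenoid.ext_baseLeaf Φ.continuous Ψ.continuous h))
  choose Φ hΦ hΦγ using Solenoid.exists_homeomorph_extension hG
  let ρ : ComAut G →* (Solenoid G ≃ₜ Solenoid G) := MonoidHom.mk' Φ fun γ δ => hext _ _ fun z => by
    change _ = Φ γ (Φ δ _)
    rw [hΦγ, hΦγ, hΦγ, mul_smul]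
  have hρ : ∀ (γ : ComAut G) (z : 𝔻), ρ γ (Solenoid.proj G z 1) = Solenoid.proj G (γ • z) 1 := hΦγ
  refine ⟨ρ, hρ, fun ρ' hρ' => MonoidHom.ext fun γ => hext _ _ fun z => by rw [hρ, hρ'], ?_, ?_⟩
  · intro γ δ h
    refine Subtype.ext (DiscAut.ext_smul fun z =>
      Solenoid.proj_one_injective hG.residuallyFinite ?_)
    exact (hρ γ z).symm.trans (h ▸ hρ δ z)
  · ext Ψ
    constructor
    · rintro ⟨γ, rfl⟩
      refine ⟨hΦ γ, ?_⟩
      ext x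
      constructor
      · rintro ⟨_, ⟨z, rfl⟩, rfl⟩
        exact ⟨γ • z, (hρ γ z).symm⟩
      · rintro ⟨z, rfl⟩
        exact ⟨_, ⟨γ⁻¹ • z, rfl⟩, (hρ γ _).trans (by rw [smul_inv_smul])⟩
    · rintro ⟨h1, h2⟩
      obtain ⟨γ, hγ⟩ := Solenoid.exists_comAut_of_isHolomorphic hG Ψ h1 h2
      exact ⟨γ, hext _ _ fun z => by rw [hρ, hγ]⟩
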